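/- All graphs are finite and simple, with at least one vertex. A graph is $m$-edge-connected if it remains connected after the removal of any fewer than $m$ edges. A tour is a closed walk that repeats no edge. A graph $G$ is $k$-edge-ordered if for every sequence $e_1,\dots,e_k$ of $k$ distinct edges of $G$ there is a tour in $G$ that contains these $k$ edges in the specified order. Proposition 6.2. For every integer $k\ge 0$ there is an $m$ such that every $m$-edge-connected graph is $k$-edge-ordered, and the least such $m$, denoted $g(k)$, satisfies $g(k)\le 2k+2$. -/

import Mathlib

universe u

/-- `G` is `k`-edge-ordered: for every sequence `e 0, …, e (k - 1)` of `k` distinct edges there is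
a tour (a closed walk that repeats no edge) whose sequence of traversed edges contains
`e 0, …, e (k - 1)` in this order. The base point of the tour is existentially quantified, so it is
immaterial where the cyclic sequence of traversed edges is cut open; each edge may be traversed in
either direction. -/
def SimpleGraph.IsEdgeOrdered {V : Type u} (G : SimpleGraph V) (k : ℕ) : Prop :=
  ∀ e : Fin k → Sym2 V, Function.Injective e → (∀ i, e i ∈ G.edgeSet) →
    ∃ (v : V) (p : G.Walk v v), p.IsTrail ∧ (List.ofFn e).Sublist p.edges

/-- The set of all `m` such that `m`-edge-connectivity implies `k`-edge-orderedness, for all finite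
simple graphs (with at least one vertex). -/
def edgeOrderingConnectivities (k : ℕ) : Set ℕ :=
  {m | ∀ (V : Type u) [Finite V] [Nonempty V] (G : SimpleGraph V),
    G.IsEdgeConnected m → G.IsEdgeOrdered k}

/-- `g(k)`: the minimum edge-connectivity that implies `k`-edge-orderedness. (The infimum is
attained exactly if some edge-connectivity implies `k`-edge-orderedness.) -/
noncomputable def minEdgeOrderingConnectivity (k : ℕ) : ℕ :=
  sInf (edgeOrderingConnectivities.{u} k)

namespace SimpleGraph

variable {V : Type u}

/-! ### Components and bridges -/

section Components

/-! Already `2 * k`-edge-connectivity suffices. In a partition into `p ≥ 2` classes each class sends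
out at least `2 * k` edges, so at least `k * p` edges cross, and at least `k * (p - 1)` of them
survive deletion of the `k` prescribed edges. By tree packing the surviving edges split into `k`
connected spanning classes; a path in class `i` joins the end of `e i` to the start of the
cyclically next edge, and disjointness of the classes makes the closed walk a tour.

Tree packing takes a colouring with fewest monochromatic components in total. Let `K` consist of the
edges that become redundant after some redundant recolourings. By `reachable_flexibleClass_of_mem`,
every colour connects each component of `K` from within, while the edges between components of `K`
are bridges of their colours. Counting components against the partition hypothesis leaves one
component per colour. -/

lemma Reachable.of_forall_adj {A B : SimpleGraph V} (h : ∀ x y, A.Adj x y → B.Reachable x y)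
    {x y : V} (hxy : A.Reachable x y) : B.Reachable x y := by
  obtain ⟨p⟩ := hxy
  induction p with
  | nil => exact .rfl
  | cons hadj _ ih => exact (h _ _ hadj).trans ih

lemma card_connectedComponent_le [Finite V] {A B : SimpleGraph V}
    (h : ∀ x y, A.Reachable x y → B.Reachable x y) :
    Nat.card B.ConnectedComponent ≤ Nat.card A.ConnectedComponent := by
  refine Nat.card_le_card_of_surjective
    (Quot.lift B.connectedComponentMk fun x y hxy ↦ ConnectedComponent.sound (h x y hxy)) ?_
  exact Quot.ind fun v ↦ ⟨A.connectedComponentMk v, rfl⟩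

lemma card_connectedComponent_lt [Finite V] {A B : SimpleGraph V}
    (h : ∀ x y, A.Reachable x y → B.Reachable x y) {u v : V} (hB : B.Reachable u v)
    (hA : ¬ A.Reachable u v) :
    Nat.card B.ConnectedComponent < Nat.card A.ConnectedComponent := by
  let f : A.ConnectedComponent → B.ConnectedComponent :=
    Quot.lift B.connectedComponentMk fun x y hxy ↦ ConnectedComponent.sound (h x y hxy)
  have hf : Function.Surjective f := Quot.ind fun v ↦ ⟨A.connectedComponentMk v, rfl⟩
  refine lt_of_le_of_ne (Nat.card_le_card_of_surjective f hf) fun hcard ↦ hA ?_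
  have hbij := (Nat.bijective_iff_surjective_and_card f).2 ⟨hf, hcard.symm⟩
  exact ConnectedComponent.exact (hbij.1
    (a₁ := A.connectedComponentMk u) (a₂ := A.connectedComponentMk v)
    (ConnectedComponent.sound hB))

/-- Deleting a set of bridges creates a new component for every bridge. -/
lemma card_connectedComponent_add_card_le [Finite V] (A : SimpleGraph V) (B : Finset (Sym2 V))
    (hB : ∀ e ∈ B, e ∈ A.edgeSet ∧ A.IsBridge e) :
    Nat.card A.ConnectedComponent + B.card ≤
      Nat.card (A.deleteEdges (B : Set (Sym2 V))).ConnectedComponent := by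
  classical
  induction B using Finset.induction_on with
  | empty => simp
  | insert e B he ih =>
    have ih := ih fun f hf ↦ hB f (Finset.mem_insert_of_mem hf)
    obtain ⟨heA, hbr⟩ := hB e (Finset.mem_insert_self _ _)
    induction e with
    | h u v =>
    have hlt : Nat.card (A.deleteEdges (B : Set (Sym2 V))).ConnectedComponent <
        Nat.card (A.deleteEdges
          ((insert s(u, v) B : Finset (Sym2 V)) : Set (Sym2 V))).ConnectedComponent := by
      refine card_connectedComponent_lt (u := u) (v := v)
        (fun x y hxy ↦ hxy.mono (deleteEdges_anti (by simp))) ?_ ?_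
      · exact Adj.reachable (by
          rw [deleteEdges_adj]
          exact ⟨heA, by simpa using he⟩)
      · intro hr
        exact isBridge_iff.1 hbr (hr.mono (deleteEdges_anti (by simp)))
    rw [Finset.card_insert_of_notMem he]
    omega

/-- The ends of an edge that is not a bridge are joined by a walk that avoids this edge and all
bridges. -/
lemma exists_walk_of_not_isBridge {A : SimpleGraph V} {u v : V} (huv : A.Adj u v)
    (hb : ¬ A.IsBridge s(u, v)) :
    ∃ p : A.Walk u v, s(u, v) ∉ p.edges ∧ ∀ f ∈ p.edges, ¬ A.IsBridge f := by
  classical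
  rw [isBridge_iff, not_not, reachable_deleteEdges_iff_exists_walk] at hb
  obtain ⟨p, hp⟩ := hb
  have hp' : s(u, v) ∉ p.bypass.edges := fun h ↦ hp (p.edges_bypass_subset_edges h)
  -- The bypassing path closes up with the edge to a cycle, and no bridge lies on a cycle.
  have hc : (Walk.cons huv.symm p.bypass).IsCycle := by
    rw [Walk.cons_isCycle_iff]
    exact ⟨p.bypass_isPath, by rwa [Sym2.eq_swap]⟩
  refine ⟨p.bypass, hp', fun f hf hbf ↦ hbf.notMem_edges_of_isCycle hc ?_⟩
  simp [hf]

end Components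

/-! ### Tree packing by recolouring redundant edges -/

section TreePacking

variable {ι : Type*} (H : SimpleGraph V)

/-- The subgraph formed by the edges of colour `j`. -/
def colorClass (c : Sym2 V → ι) (j : ι) : SimpleGraph V :=
  fromEdgeSet {e | e ∈ H.edgeSet ∧ c e = j}

/-- The subgraph formed by the edges between different classes of an equivalence relation. -/
def crossing (r : Setoid V) : SimpleGraph V where
  Adj x y := H.Adj x y ∧ ¬ r x y
  symm := ⟨fun _ _ h ↦ ⟨h.1.symm, fun h' ↦ h.2 (r.symm h')⟩⟩
  loopless := ⟨fun _ h ↦ H.irrefl h.1⟩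

/-- An edge is redundant for a colouring if it lies on a monochromatic cycle. -/
def IsRedundant (c : Sym2 V → ι) (e : Sym2 V) : Prop :=
  e ∈ H.edgeSet ∧ ¬ (H.colorClass c (c e)).IsBridge e

/-- The colourings obtained from `c₀` by successively changing colours of redundant edges. -/
inductive Recoloring [DecidableEq (Sym2 V)] (c₀ : Sym2 V → ι) : (Sym2 V → ι) → Prop
  | refl : Recoloring c₀ c₀
  | step (c : Sym2 V → ι) (e : Sym2 V) (j : ι) : Recoloring c₀ c → H.IsRedundant c e →
      Recoloring c₀ (Function.update c e j)

/-- The edges that are redundant in some recolouring of `c₀`. -/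
def flexibleEdges [DecidableEq (Sym2 V)] (c₀ : Sym2 V → ι) : Set (Sym2 V) :=
  {e | ∃ c, H.Recoloring c₀ c ∧ H.IsRedundant c e}

/-- The total number of components of the colour classes. -/
noncomputable def totalComponents [Fintype ι] (c : Sym2 V → ι) : ℕ :=
  ∑ j, Nat.card (H.colorClass c j).ConnectedComponent

variable {H}

lemma colorClass_adj {c : Sym2 V → ι} {j : ι} {x y : V} :
    (H.colorClass c j).Adj x y ↔ H.Adj x y ∧ c s(x, y) = j := by
  simp only [colorClass, fromEdgeSet_adj, Set.mem_ofPred_eq, mem_edgeSet]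
  exact ⟨fun h ↦ h.1, fun h ↦ ⟨h, h.1.ne⟩⟩

lemma mem_edgeSet_colorClass {c : Sym2 V → ι} {j : ι} {e : Sym2 V} :
    e ∈ (H.colorClass c j).edgeSet ↔ e ∈ H.edgeSet ∧ c e = j := by
  induction e with
  | h x y => simp [colorClass_adj]

section Recoloring

variable [DecidableEq (Sym2 V)]

lemma IsRedundant.reachable_update {c : Sym2 V → ι} {e : Sym2 V} (he : H.IsRedundant c e)
    (i j : ι) {x y : V} (h : (H.colorClass c i).Reachable x y) :
    (H.colorClass (Function.update c e j) i).Reachable x y := by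
  refine Reachable.of_forall_adj (fun u v huv ↦ ?_) h
  rw [colorClass_adj] at huv
  by_cases hne : s(u, v) = e
  · subst hne
    obtain ⟨-, hb⟩ := he
    rw [isBridge_iff, not_not] at hb
    refine hb.mono fun a b hab ↦ ?_
    rw [deleteEdges_adj, colorClass_adj] at hab
    rw [colorClass_adj, Function.update_of_ne (by simpa using hab.2)]
    exact ⟨hab.1.1, hab.1.2.trans huv.2⟩
  · refine Adj.reachable ?_
    rw [colorClass_adj, Function.update_of_ne hne]
    exact huv

lemma IsRedundant.totalComponents_update_le [Finite V] [Fintype ι] {c : Sym2 V → ι}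
    {e : Sym2 V} (he : H.IsRedundant c e) (j : ι) :
    H.totalComponents (Function.update c e j) ≤ H.totalComponents c :=
  Finset.sum_le_sum fun i _ ↦ card_connectedComponent_le fun _ _ h ↦ he.reachable_update i j h

/-- Otherwise giving the edge colour `j` would merge two components of that colour without splitting
any other, contradicting minimality. -/
lemma IsRedundant.reachable_of_minimal [Finite V] [Fintype ι] {c : Sym2 V → ι}
    (hc : ∀ c' : Sym2 V → ι, H.totalComponents c ≤ H.totalComponents c') {u v : V}
    (he : H.IsRedundant c s(u, v)) (j : ι) : (H.colorClass c j).Reachable u v := by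
  by_contra hr
  refine (hc (Function.update c s(u, v) j)).not_gt ?_
  refine Finset.sum_lt_sum
    (fun i _ ↦ card_connectedComponent_le fun _ _ h ↦ he.reachable_update i j h)
    ⟨j, Finset.mem_univ _, card_connectedComponent_lt
      (fun _ _ h ↦ he.reachable_update j j h) (Adj.reachable ?_) hr⟩
  rw [colorClass_adj]
  exact ⟨he.1, by simp⟩

lemma Recoloring.minimal [Finite V] [Fintype ι] {c₀ c : Sym2 V → ι}
    (hc₀ : ∀ c' : Sym2 V → ι, H.totalComponents c₀ ≤ H.totalComponents c') (h : H.Recoloring c₀ c) :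
    ∀ c' : Sym2 V → ι, H.totalComponents c ≤ H.totalComponents c' := by
  induction h with
  | refl => exact hc₀
  | step c e j _ he ih => exact fun c' ↦ (he.totalComponents_update_le j).trans (ih c')

variable (H) in
/-- The flexible edges of `c₀` that have colour `j` in `c`. -/
def flexibleClass (c₀ c : Sym2 V → ι) (j : ι) : SimpleGraph V :=
  fromEdgeSet {e | e ∈ H.flexibleEdges c₀ ∧ c e = j}

lemma flexibleEdges_subset (c₀ : Sym2 V → ι) : H.flexibleEdges c₀ ⊆ H.edgeSet :=
  fun _ ⟨_, _, he⟩ ↦ he.1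

lemma flexibleClass_adj {c₀ c : Sym2 V → ι} {j : ι} {x y : V} :
    (H.flexibleClass c₀ c j).Adj x y ↔ s(x, y) ∈ H.flexibleEdges c₀ ∧ c s(x, y) = j := by
  simp only [flexibleClass, fromEdgeSet_adj, Set.mem_ofPred_eq]
  exact ⟨fun h ↦ h.1, fun h ↦ ⟨h, Adj.ne (flexibleEdges_subset c₀ h.1)⟩⟩

/-- A monochromatic cycle through `e` consists of redundant, hence flexible, edges, so the rest of
it still joins the ends of `e` after the recolouring. -/
lemma IsRedundant.reachable_flexibleClass_update {c₀ c : Sym2 V → ι}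
    (hc : H.Recoloring c₀ c) {e : Sym2 V} (he : H.IsRedundant c e) (i j : ι) {x y : V}
    (h : (H.flexibleClass c₀ c i).Reachable x y) :
    (H.flexibleClass c₀ (Function.update c e j) i).Reachable x y := by
  refine Reachable.of_forall_adj (fun u v huv ↦ ?_) h
  rw [flexibleClass_adj] at huv
  by_cases hne : s(u, v) = e
  · subst hne
    obtain ⟨heH, hb⟩ := he
    rw [huv.2] at hb
    obtain ⟨p, hp, hpb⟩ := exists_walk_of_not_isBridge (colorClass_adj.2 ⟨heH, huv.2⟩) hb
    refine ⟨p.transfer _ fun f hf ↦ ?_⟩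
    have hfi := mem_edgeSet_colorClass.1 (p.edges_subset_edgeSet hf)
    have hfe : f ≠ s(u, v) := fun h ↦ hp (h ▸ hf)
    have hfS : f ∈ H.flexibleEdges c₀ := ⟨c, hc, hfi.1, by rw [hfi.2]; exact hpb f hf⟩
    induction f with
    | h a b =>
      rw [mem_edgeSet, flexibleClass_adj, Function.update_of_ne hfe]
      exact ⟨hfS, hfi.2⟩
  · refine Adj.reachable ?_
    rw [flexibleClass_adj, Function.update_of_ne hne]
    exact huv

/-- The recolourings can be undone one at a time, each reversal being itself the recolouring of a
redundant edge. -/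
lemma Recoloring.reachable_flexibleClass [Finite V] [Fintype ι] {c₀ c : Sym2 V → ι}
    (hc₀ : ∀ c' : Sym2 V → ι, H.totalComponents c₀ ≤ H.totalComponents c') (hc : H.Recoloring c₀ c) (i : ι)
    {x y : V} (h : (H.flexibleClass c₀ c i).Reachable x y) :
    (H.flexibleClass c₀ c₀ i).Reachable x y := by
  induction hc generalizing x y with
  | refl => exact h
  | step c e j hc he ih =>
    apply ih
    by_cases hj : c e = j
    · rwa [← hj, Function.update_eq_self] at h
    -- By minimality the ends of `e` were already joined in colour `j`, so `e` closes a cycle in its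
    -- new colour.
    have he' : H.IsRedundant (Function.update c e j) e := by
      refine ⟨he.1, ?_⟩
      induction e with
      | h u v =>
      rw [isBridge_iff, not_not]
      refine (he.reachable_of_minimal (hc.minimal hc₀) j).mono fun a b hab ↦ ?_
      rw [colorClass_adj] at hab
      have hne : s(a, b) ≠ s(u, v) := fun h ↦ hj (h ▸ hab.2)
      rw [deleteEdges_adj, colorClass_adj, Function.update_self, Function.update_of_ne hne]
      exact ⟨hab, by simpa using hne⟩
    have := he'.reachable_flexibleClass_update (hc.step c e j he) i (c e) h
    rwa [Function.update_idem, Function.update_eq_self] at this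

lemma reachable_flexibleClass_of_mem [Finite V] [Fintype ι] {c₀ : Sym2 V → ι}
    (hc₀ : ∀ c' : Sym2 V → ι, H.totalComponents c₀ ≤ H.totalComponents c') {u v : V}
    (h : s(u, v) ∈ H.flexibleEdges c₀) (j : ι) : (H.flexibleClass c₀ c₀ j).Reachable u v := by
  obtain ⟨c, hc, he⟩ := id h
  refine (hc.step c _ j he).reachable_flexibleClass hc₀ j (Adj.reachable ?_)
  rw [flexibleClass_adj]
  exact ⟨h, by simp⟩

end Recoloring

/-- **Tree packing theorem** (Nash-Williams, Tutte): if for every partition of the vertex set into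
`p` classes there are at least `k * (p - 1)` edges between different classes, then the edges can be
coloured with `k` colours such that every colour class is connected and spanning. -/
theorem exists_coloring_preconnected [Finite V] [Nonempty V] [Fintype ι] [Nonempty ι]
    (h : ∀ r : Setoid V, Fintype.card ι * Nat.card (Quotient r) ≤
      (H.crossing r).edgeSet.ncard + Fintype.card ι) :
    ∃ c : Sym2 V → ι, ∀ j, (H.colorClass c j).Preconnected := by
  classical
  obtain ⟨c, -, hmin⟩ := exists_minimalFor_of_wellFoundedLT (fun _ : Sym2 V → ι ↦ True)
    H.totalComponents ⟨fun _ ↦ Classical.arbitrary ι, trivial⟩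
  have hc : ∀ c' : Sym2 V → ι, H.totalComponents c ≤ H.totalComponents c' := fun c' ↦
    (le_total _ _).elim id (hmin (j := c') trivial)
  refine ⟨c, ?_⟩
  set K : SimpleGraph V := fromEdgeSet (H.flexibleEdges c)
  have hKc : ∀ j x y, K.Reachable x y → (H.flexibleClass c c j).Reachable x y := by
    refine fun j x y hxy ↦ Reachable.of_forall_adj (fun u v huv ↦ ?_) hxy
    exact reachable_flexibleClass_of_mem hc ((fromEdgeSet_adj _).1 huv).1 j
  -- The partition to be tested is that into the components of `K`.
  set X : SimpleGraph V := H.crossing K.reachableSetoid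
  have hXadj : ∀ x y, X.Adj x y ↔ H.Adj x y ∧ ¬ K.Reachable x y := fun _ _ ↦ Iff.rfl
  let B : ι → Finset (Sym2 V) := fun j ↦ {e ∈ X.edgeSet.toFinite.toFinset | c e = j}
  have hB : ∀ j e, e ∈ B j ↔ e ∈ X.edgeSet ∧ c e = j := fun j e ↦ by simp [B]
  have hBcard : ∑ j, (B j).card = X.edgeSet.ncard := by
    rw [Set.ncard_eq_toFinset_card _ X.edgeSet.toFinite]
    exact (Finset.card_eq_sum_card_fiberwise fun _ _ ↦ Finset.mem_coe.2 (Finset.mem_univ _)).symm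
  have hbridge : ∀ j, ∀ e ∈ B j, e ∈ (H.colorClass c j).edgeSet ∧
      (H.colorClass c j).IsBridge e := by
    intro j e he
    rw [hB] at he
    obtain ⟨heX, rfl⟩ := he
    induction e with
    | h u v =>
      obtain ⟨huv, hr⟩ := (hXadj u v).1 heX
      refine ⟨colorClass_adj.2 ⟨huv, rfl⟩, ?_⟩
      by_contra hb
      exact hr (Adj.reachable ((fromEdgeSet_adj _).2 ⟨⟨c, .refl, huv, hb⟩, huv.ne⟩))
  -- Without its bridges in `B j`, colour `j` still connects each component of `K`.
  have hle : ∀ j, Nat.card (H.colorClass c j).ConnectedComponent + (B j).card ≤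
      Nat.card K.ConnectedComponent := by
    intro j
    refine (card_connectedComponent_add_card_le _ _ (hbridge j)).trans
      (card_connectedComponent_le fun x y hxy ↦ (hKc j x y hxy).mono fun u v huv ↦ ?_)
    rw [flexibleClass_adj] at huv
    rw [deleteEdges_adj, colorClass_adj]
    refine ⟨⟨flexibleEdges_subset c huv.1, huv.2⟩, fun hmem ↦ ?_⟩
    have hmem := ((hXadj u v).1 ((hB j _).1 (Finset.mem_coe.1 hmem)).1).2
    exact hmem (Adj.reachable ((fromEdgeSet_adj _).2
      ⟨huv.1, Adj.ne (flexibleEdges_subset c huv.1)⟩))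
  have hsum := Finset.sum_le_sum fun j (_ : j ∈ Finset.univ) ↦ hle j
  rw [Finset.sum_add_distrib, hBcard, Finset.sum_const, Finset.card_univ, smul_eq_mul] at hsum
  have hr : Fintype.card ι * Nat.card K.ConnectedComponent ≤
    X.edgeSet.ncard + Fintype.card ι := h K.reachableSetoid
  have htotal : ∑ j, Nat.card (H.colorClass c j).ConnectedComponent ≤ ∑ _j : ι, 1 := by
    simp only [Finset.sum_const, Finset.card_univ, smul_eq_mul, mul_one]
    omega
  have hone : ∀ j ∈ Finset.univ, 1 ≤ Nat.card (H.colorClass c j).ConnectedComponent :=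
    fun _ _ ↦ Nat.card_pos
  have heq := (Finset.sum_eq_sum_iff_of_le hone).1
    (le_antisymm (Finset.sum_le_sum hone) htotal)
  intro j x y
  have := (Nat.card_eq_one_iff_unique.1 (heq j (Finset.mem_univ _)).symm).1
  exact ConnectedComponent.exact (Subsingleton.elim _ _)

end TreePacking

/-! ### Edges across a partition -/

section EdgeConnectivity

/-- In a `2 * k`-edge-connected graph, a partition into `p ≥ 2` classes has at least `k * p` edges
between different classes. -/
lemma IsEdgeConnected.mul_card_quotient_le [Finite V] {G : SimpleGraph V} {k : ℕ}
    (hG : G.IsEdgeConnected (2 * k)) (r : Setoid V) [Nontrivial (Quotient r)] :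
    k * Nat.card (Quotient r) ≤ (G.crossing r).edgeSet.ncard := by
  classical
  have := Fintype.ofFinite (Quotient r)
  set X := G.crossing r
  have hXadj : ∀ x y, X.Adj x y ↔ G.Adj x y ∧ (⟦x⟧ : Quotient r) ≠ ⟦y⟧ := fun x y ↦
    and_congr_right fun _ ↦ not_congr Quotient.eq.symm
  let inc : Quotient r → Sym2 V → Prop := fun C e ↦ C ∈ e.map (Quotient.mk r)
  -- Double counting of incidences between classes and crossing edges: at least `2 * k` per class,
  -- at most two per edge.
  have hboundary : ∀ C ∈ (Finset.univ : Finset (Quotient r)),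
      2 * k ≤ (X.edgeSet.toFinite.toFinset.bipartiteAbove inc C).card := by
    intro C _
    by_contra! hlt
    obtain ⟨D, hD⟩ := exists_ne C
    obtain ⟨x, rfl⟩ := Quotient.exists_rep C
    obtain ⟨y, rfl⟩ := Quotient.exists_rep D
    have hreach := hG x y
      (s := (X.edgeSet.toFinite.toFinset.bipartiteAbove inc ⟦x⟧ : Finset (Sym2 V)))
      (by rw [Set.encard_coe_eq_coe_finsetCard]; exact_mod_cast hlt)
    obtain ⟨p⟩ := hreach
    have hclass : ∀ {a b : V}, (G.deleteEdges (X.edgeSet.toFinite.toFinset.bipartiteAbove inc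
        (⟦x⟧ : Quotient r) : Finset (Sym2 V))).Walk a b →
        (⟦a⟧ : Quotient r) = ⟦x⟧ → (⟦b⟧ : Quotient r) = ⟦x⟧ := by
      intro a b q
      induction q with
      | nil => exact id
      | @cons a b _ hadj _ ih =>
        intro ha
        apply ih
        by_contra hb
        rw [deleteEdges_adj] at hadj
        refine hadj.2 ?_
        simp only [Finset.mem_coe, Finset.mem_bipartiteAbove, Set.Finite.mem_toFinset,
          mem_edgeSet]
        refine ⟨(hXadj a b).2 ⟨hadj.1, fun h ↦ hb (h.symm.trans ha)⟩, ?_⟩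
        simp [inc, ha]
    exact hD (hclass p rfl)
  have hends : ∀ e ∈ X.edgeSet.toFinite.toFinset,
      ((Finset.univ : Finset (Quotient r)).bipartiteBelow inc e).card ≤ 2 := by
    intro e _
    induction e with
    | h a b =>
      refine (Finset.card_le_card (t := {⟦a⟧, ⟦b⟧}) fun C hC ↦ ?_).trans Finset.card_le_two
      simpa [inc, Finset.mem_bipartiteBelow, eq_comm] using hC
  have := Finset.card_mul_le_card_mul inc hboundary hends
  rw [Finset.card_univ, ← Nat.card_eq_fintype_card,
    ← Set.ncard_eq_toFinset_card _ X.edgeSet.toFinite] at this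
  nlinarith

end EdgeConnectivity

/-! ### Construction of the tour -/

section Tours

/-- Given edges `s(a i, b i)` and walks from `b i` to `a (i + 1)`, the walk that traverses them
alternately. -/
lemma exists_walk_edges_eq_flatMap {G : SimpleGraph V} (a b : ℕ → V) (hab : ∀ i, G.Adj (a i) (b i))
    (p : ∀ i, G.Walk (b i) (a (i + 1))) (n : ℕ) :
    ∃ w : G.Walk (a 0) (a n),
      w.edges = (List.range n).flatMap fun i ↦ s(a i, b i) :: (p i).edges := by
  induction n with
  | zero => exact ⟨.nil, by simp⟩
  | succ n ih =>
    obtain ⟨w, hw⟩ := ih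
    exact ⟨w.append (.cons (hab n) (p n)), by
      simp [Walk.edges_append, hw, List.range_succ, List.flatMap_append]⟩

/-- A `2 * k`-edge-connected graph is `k`-edge-ordered. -/
theorem IsEdgeConnected.isEdgeOrdered [Finite V] [Nonempty V] {G : SimpleGraph V} {k : ℕ}
    (hG : G.IsEdgeConnected (2 * k)) : G.IsEdgeOrdered k := by
  classical
  intro e he_inj heG
  obtain rfl | hk := Nat.eq_zero_or_pos k
  · exact ⟨Classical.arbitrary V, .nil, by simp, by simp⟩
  have : NeZero k := ⟨hk.ne'⟩
  have : Nonempty (Fin k) := ⟨0⟩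
  set H : SimpleGraph V := G.deleteEdges (Set.range e) with hH
  obtain ⟨c, hc⟩ : ∃ c : Sym2 V → Fin k, ∀ j, (H.colorClass c j).Preconnected := by
    refine exists_coloring_preconnected fun r ↦ ?_
    rw [Fintype.card_fin]
    have : Nonempty (Quotient r) := Nonempty.map (Quotient.mk r) ‹_›
    obtain hsub | hnt := subsingleton_or_nontrivial (Quotient r)
    · rw [Nat.card_eq_one_iff_unique.2 ⟨hsub, this⟩]
      omega
    -- The at most `k` deleted crossing edges are absorbed by the summand `k` in the tree packing
    -- condition.
    · refine (hG.mul_card_quotient_le r).trans ?_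
      have hsub : (G.crossing r).edgeSet ⊆ (H.crossing r).edgeSet ∪ Set.range e := by
        intro f hf
        by_cases hfe : f ∈ Set.range e
        · exact .inr hfe
        · refine .inl ?_
          induction f with
          | h x y => exact ⟨by rw [hH, deleteEdges_adj]; exact ⟨hf.1, hfe⟩, hf.2⟩
      refine (Set.ncard_le_ncard hsub (Set.toFinite _)).trans
        ((Set.ncard_union_le _ _).trans (Nat.add_le_add_left ?_ _))
      rw [← Set.image_univ, Set.ncard_image_of_injective _ he_inj, Set.ncard_univ, Nat.card_fin]
  have hends : ∀ i, ∃ x : V × V, e i = s(x.1, x.2) := fun i ↦ by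
    induction e i with
    | h x y => exact ⟨(x, y), rfl⟩
  choose x hx using hends
  -- Indices are read modulo `k`, so that `a k = a 0` closes the walk.
  let a : ℕ → V := fun i ↦ (x (Fin.ofNat k i)).1
  let b : ℕ → V := fun i ↦ (x (Fin.ofNat k i)).2
  have hab : ∀ i, s(a i, b i) = e (Fin.ofNat k i) := fun i ↦ (hx _).symm
  have hpath : ∀ i, ∃ p : G.Walk (b i) (a (i + 1)), p.IsTrail ∧
      ∀ f ∈ p.edges, f ∉ Set.range e ∧ c f = Fin.ofNat k i := by
    intro i
    obtain ⟨q, hq⟩ := (hc (Fin.ofNat k i) (b i) (a (i + 1))).exists_isPath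
    have hqH : ∀ f ∈ q.edges, f ∈ H.edgeSet ∧ c f = Fin.ofNat k i := fun f hf ↦
      mem_edgeSet_colorClass.1 (q.edges_subset_edgeSet hf)
    have hHG : ∀ f ∈ H.edgeSet, f ∈ G.edgeSet ∧ f ∉ Set.range e := by
      intro f hf
      rwa [hH, edgeSet_deleteEdges] at hf
    refine ⟨q.transfer G fun f hf ↦ (hHG f (hqH f hf).1).1, (hq.transfer _).isTrail, fun f hf ↦ ?_⟩
    rw [Walk.edges_transfer] at hf
    exact ⟨(hHG f (hqH f hf).1).2, (hqH f hf).2⟩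
  choose p hp hpe using hpath
  obtain ⟨w, hw⟩ := exists_walk_edges_eq_flatMap a b
    (fun i ↦ by rw [← mem_edgeSet, hab]; exact heG _) p k
  have hclose : a k = a 0 := by simp [a]
  refine ⟨a 0, w.copy rfl hclose, ?_, ?_⟩
  · rw [Walk.isTrail_copy, Walk.isTrail_def, hw, List.nodup_flatMap]
    refine ⟨fun i _ ↦ List.nodup_cons.2 ⟨fun hmem ↦ ?_, (hp i).edges_nodup⟩, ?_⟩
    · exact (hpe i _ hmem).1 ⟨_, (hab i).symm⟩
    -- Different blocks share no edge: `e` is injective, the paths avoid its range, and different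
    -- paths have different colours.
    · refine List.Pairwise.imp_of_mem ?_ List.nodup_range
      intro i j hi hj hij
      have hne : Fin.ofNat k i ≠ Fin.ofNat k j := by
        intro h
        rw [List.mem_range] at hi hj
        simp [Fin.ofNat, Nat.mod_eq_of_lt hi, Nat.mod_eq_of_lt hj, hij] at h
      intro f hfi hfj
      rw [List.mem_cons, hab] at hfi hfj
      rcases hfi with rfl | hfi
      · rcases hfj with hfj | hfj
        · exact hne (he_inj hfj)
        · exact (hpe j _ hfj).1 ⟨_, rfl⟩
      · rcases hfj with rfl | hfj
        · exact (hpe i _ hfi).1 ⟨_, rfl⟩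
        · exact hne ((hpe i _ hfi).2.symm.trans (hpe j _ hfj).2)
  · rw [Walk.edges_copy, hw]
    have hlist : List.ofFn e = (List.range k).flatMap fun i ↦ [e (Fin.ofNat k i)] := by
      rw [← List.map_eq_flatMap]
      refine List.ext_getElem (by simp) fun i hi _ ↦ ?_
      rw [List.length_ofFn] at hi
      simp [Fin.ofNat, Nat.mod_eq_of_lt hi]
    rw [hlist]
    generalize List.range k = l
    induction l with
    | nil => simp
    | cons i l ih =>
      simp only [List.flatMap_cons, hab]
      exact List.Sublist.append (by simp) (by simpa only [hab] using ih)

end Tours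

end SimpleGraph

theorem proposition6p2 (k : ℕ) :
    IsLeast (edgeOrderingConnectivities.{u} k) (minEdgeOrderingConnectivity.{u} k) ∧
      minEdgeOrderingConnectivity.{u} k ≤ 2 * k + 2 := by
  have hmem : 2 * k + 2 ∈ edgeOrderingConnectivities.{u} k := fun V _ _ G hG ↦
    SimpleGraph.IsEdgeConnected.isEdgeOrdered fun u v ↦ (hG u v).anti (by omega)
  exact ⟨⟨Nat.sInf_mem ⟨_, hmem⟩, fun _ hm ↦ Nat.sInf_le hm⟩, Nat.sInf_le hmem⟩
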